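/- Let $\mathcal A$ be a finite set with the discrete topology, give $\mathcal A^{\mathbb Z}$ the product topology, and let $\sigma(x)_i = x_{i+1}$. Let $X \subseteq \mathcal A^{\mathbb Z}$ be a sofic shift, that is, a closed set with $\sigma(X) = X$ which is the set of label sequences of all bi-infinite walks on some finite directed graph whose edges are labeled by elements of $\mathcal A$; let $\sigma_X$ be the restriction of $\sigma$ to $X$. Let $\varphi : X \to X$ be a homeomorphism with $\sigma_X \circ \varphi = \varphi \circ \sigma_X^{-1}$ (a reversal) of finite order $2r$, that is, $2r$ is the least positive integer $s$ with $\varphi^s = \mathrm{id}_X$, where $r \ge 1$ is an integer. For integers $m \ge 1$ and $0 \le l < r$ let $$f_{\sigma_X,\varphi}(m,2l) = \bigl|\{x \in X : \sigma_X^m(\varphi^{2l}(x)) = x\}\bigr| .$$ Then there are an integer $n$ and square matrices $A_k$ and $J_k$ ($k = 1, \dots, n$) with integer entries, $A_k$ and $J_k$ having the same size for each $k$, such that for all integers $m \ge 1$ and $0 \le l < r$ the number $f_{\sigma_X,\varphi}(m,2l)$ is finite and $$f_{\sigma_X,\varphi}(m,2l) = \sum_{k=1}^{n} (-1)^{k+1}\,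 \mathrm{tr}\bigl(A_k^{\,m} J_k^{\,2l}\bigr).$$ -/

import Mathlib

universe u

/-- The shift map on the full shift `𝒜^ℤ` (product topology), `σ(x)_i = x_{i+1}`. -/
def fullShift (𝒜 : Type u) [TopologicalSpace 𝒜] : (ℤ → 𝒜) ≃ₜ (ℤ → 𝒜) where
  toFun x := fun i => x (i + 1)
  invFun x := fun i => x (i - 1)
  left_inv x := by funext i; simp
  right_inv x := by funext i; simp
  continuous_toFun := by fun_prop
  continuous_invFun := by fun_prop

/-- A shift space over `𝒜`: a closed subset `X` of `𝒜^ℤ` with `σ⁻¹(X) = X`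
(equivalently `σ(X) = X`). -/
structure ShiftSpace (𝒜 : Type u) [TopologicalSpace 𝒜] where
  /-- The set of points of the shift space. -/
  carrier : Set (ℤ → 𝒜)
  isClosed : IsClosed carrier
  shift_mem_iff : ∀ x, fullShift 𝒜 x ∈ carrier ↔ x ∈ carrier

/-- The shift map `σ_X : X → X` of a shift space `X`, as a homeomorphism. -/
def ShiftSpace.shift {𝒜 : Type u} [TopologicalSpace 𝒜] (X : ShiftSpace 𝒜) :
    X.carrier ≃ₜ X.carrier :=
  (fullShift 𝒜).subtype fun x => (X.shift_mem_iff x).symm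

/-- A finite directed graph (loops and parallel edges allowed) whose edges are labeled by
symbols of `𝒜`. -/
structure LabeledGraph (𝒜 : Type u) where
  /-- The set of vertices. -/
  V : Type
  /-- The set of edges. -/
  E : Type
  finite_V : Finite V
  finite_E : Finite E
  /-- The initial vertex of an edge. -/
  source : E → V
  /-- The terminal vertex of an edge. -/
  target : E → V
  /-- The label of an edge. -/
  label : E → 𝒜

/-- The set of label sequences of all bi-infinite walks on a labeled graph. -/
def LabeledGraph.presented {𝒜 : Type u} (G : LabeledGraph 𝒜) : Set (ℤ → 𝒜) :=
  {x | ∃ e : ℤ → G.E, (∀ i, G.target (e i) = G.source (e (i + 1))) ∧ ∀ i, x i = G.label (e i)}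

/-- A shift space is sofic if it is presented by some finite labeled graph. -/
def ShiftSpace.IsSofic {𝒜 : Type u} [TopologicalSpace 𝒜] (X : ShiftSpace 𝒜) : Prop :=
  ∃ G : LabeledGraph 𝒜, X.carrier = G.presented

/-- A homeomorphism `R` is a reversal for the invertible system `(X, T)` if
`T ∘ R = R ∘ T⁻¹`. -/
def IsReversal {X : Type u} [TopologicalSpace X] (T R : X ≃ₜ X) : Prop :=
  ∀ x, T (R x) = R (T.symm x)

/-- The set of points fixed by `T^m ∘ R^j`. -/
def fixedSet {X : Type u} [TopologicalSpace X] (T R : X ≃ₜ X) (m j : ℕ) : Set X :=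
  {x | (T ^ m) ((R ^ j) x) = x}

/-! Since a reversal conjugates the shift to its inverse, ψ = φ² commutes with the shift, and the
points to count are those fixed by σ^m ψ^l.

Let G be the finite cyclic group generated by ψ. Replacing each x by its `itinerary`, the sequence
of symbols of all its G-translates, recodes X injectively as a set Y on which ψ acts by a
permutation τ of the alphabet. Fixed points become sequences with τ^l(y_{i+m}) = y_i, and such a
sequence is determined by its first m letters. Soficity makes the follower sets of Y finite in
number (`finite_followerSet_itinerary`), so they are the states of a deterministic presentation on
which τ acts.

Reading a word w and then applying the action of τ^l is a partial map f of the states. The twisted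
periodic sequence generated by w lies in Y exactly when f has an infinite orbit
(`image_isTwistedPeriodic`). Let M be the matrix of f. If there is an infinite orbit, M has a
nonzero fixed vector; otherwise M is nilpotent. Hence the indicator of this event is 1 - det(1 - M)
= Σ_{k≥1} (-1)^{k+1} tr Λ^k M. As Λ^k is multiplicative, summing over all words w of length m gives
tr(A_k^m B_k^l), where A_k is the sum over letters of the compounds of their transition matrices and
B_k is the compound of the permutation matrix of τ on states. A block matrix then replaces B_k^l by
an even power J_k^{2l}. -/

/-! ### Exterior powers and det(1 - M) -/

section Compound

variable {ι R : Type*} [Fintype ι] [LinearOrder ι] [CommRing R]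

/-- The `k`-th compound matrix: the matrix of the `k`-th exterior power of the linear map
given by `M`, in the standard basis. -/
noncomputable def compoundMatrix (k : ℕ) (M : Matrix ι ι R) :
    Matrix (Set.powersetCard ι k) (Set.powersetCard ι k) R :=
  LinearMap.toMatrix ((Pi.basisFun R ι).exteriorPower k) ((Pi.basisFun R ι).exteriorPower k)
    (exteriorPower.map k (Matrix.toLin' M))

theorem compoundMatrix_mul (k : ℕ) (M N : Matrix ι ι R) :
    compoundMatrix k (M * N) = compoundMatrix k M * compoundMatrix k N := by
  rw [compoundMatrix, Matrix.toLin'_mul, exteriorPower.map_comp,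
    LinearMap.toMatrix_comp _ ((Pi.basisFun R ι).exteriorPower k)]
  rfl

theorem compoundMatrix_one (k : ℕ) : compoundMatrix k (1 : Matrix ι ι R) = 1 := by
  rw [compoundMatrix, Matrix.toLin'_one, exteriorPower.map_id, LinearMap.toMatrix_id]

theorem compoundMatrix_pow (k : ℕ) (M : Matrix ι ι R) (n : ℕ) :
    compoundMatrix k (M ^ n) = compoundMatrix k M ^ n := by
  induction n with
  | zero => rw [pow_zero, pow_zero, compoundMatrix_one]
  | succ n ih => rw [pow_succ, pow_succ, compoundMatrix_mul, ih]

theorem compoundMatrix_list_prod (k : ℕ) (L : List (Matrix ι ι R)) :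
    compoundMatrix k L.prod = (L.map (compoundMatrix k)).prod := by
  induction L with
  | nil => simp [compoundMatrix_one]
  | cons a L ih => simp [compoundMatrix_mul, ih]

theorem compoundMatrix_apply_self (k : ℕ) (M : Matrix ι ι R) (s : Set.powersetCard ι k) :
    compoundMatrix k M s s =
      (M.submatrix (Subtype.val : s.1 → ι) (Subtype.val : s.1 → ι)).det := by
  have hs : s.1.card = k := s.2
  rw [compoundMatrix, LinearMap.toMatrix_apply, exteriorPower.basis_repr_apply,
    exteriorPower.basis_apply, exteriorPower.map_apply_ιMulti_family,
    exteriorPower.ιMulti_family, exteriorPower.ιMultiDual_apply_ιMulti,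
    ← Matrix.det_transpose, ← Matrix.det_submatrix_equiv_self (s.1.orderIsoOfFin hs).toEquiv]
  congr 1
  ext i j
  simp [Set.powersetCard.ofFinEmbEquiv_symm_apply]

theorem trace_compoundMatrix (k : ℕ) (M : Matrix ι ι R) :
    (compoundMatrix k M).trace = ∑ s ∈ Finset.univ.powersetCard k,
      (M.submatrix (Subtype.val : s → ι) (Subtype.val : s → ι)).det := by
  rw [Matrix.trace]
  simp only [Matrix.diag_apply, compoundMatrix_apply_self]
  refine Finset.sum_bij (fun s _ => s.1) (fun s _ => ?_) (fun s _ t _ h => Subtype.ext h)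
    (fun s hs => ⟨⟨s, ?_⟩, Finset.mem_univ _, rfl⟩) (fun s _ => rfl)
  · exact Finset.mem_powersetCard.2 ⟨Finset.subset_univ _, s.2⟩
  · exact (Finset.mem_powersetCard.1 hs).2

/-- This is the characteristic polynomial at 1. The sum is reflected because the principal minors of
size k give the coefficient in codegree k. -/
theorem det_one_sub_eq_sum_trace_compoundMatrix (M : Matrix ι ι R) :
    (1 - M).det = ∑ k ∈ Finset.range (Fintype.card ι + 1),
      (-1) ^ k * (compoundMatrix k M).trace := by
  nontriviality R
  have h := M.eval_charpoly 1
  rw [Polynomial.eval_eq_sum_range, M.charpoly_natDegree_eq_dim, ← Finset.sum_range_reflect] at h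
  rw [map_one] at h
  rw [← h]
  refine Finset.sum_congr rfl fun k hk => ?_
  have hk' : k ≤ Fintype.card ι := by simpa [Nat.lt_succ_iff] using hk
  rw [one_pow, mul_one, show Fintype.card ι + 1 - 1 - k = Fintype.card ι - k by omega,
    Matrix.charpoly_coeff_eq_sum_minors M k hk', trace_compoundMatrix]

theorem one_sub_det_one_sub_eq_sum_trace_compoundMatrix (M : Matrix ι ι R) :
    1 - (1 - M).det = ∑ k ∈ Finset.Icc 1 (Fintype.card ι),
      (-1) ^ (k + 1) * (compoundMatrix k M).trace := by
  rw [det_one_sub_eq_sum_trace_compoundMatrix, Finset.range_eq_Ico,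
    Finset.sum_eq_sum_Ico_succ_bot (by omega), trace_compoundMatrix 0,
    Finset.powersetCard_zero, Finset.sum_singleton, Matrix.det_isEmpty]
  simp only [pow_zero, one_mul, sub_add_cancel_left, ← Finset.sum_neg_distrib, pow_succ]
  refine Finset.sum_congr ?_ fun k _ => by ring
  ext k
  simp [Nat.succ_le_iff]

end Compound

/-! ### Square roots by doubling -/

section Blocks

variable {ι : Type*} [Fintype ι] [DecidableEq ι]

/-- Doubling the index set provides `B` with a square root without changing traces. -/
theorem trace_fromBlocks_pow_mul_pow (A B : Matrix ι ι ℤ) {m : ℕ} (hm : 1 ≤ m) (l : ℕ) :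
    Matrix.trace (Matrix.fromBlocks A 0 0 (0 : Matrix ι ι ℤ) ^ m *
        Matrix.fromBlocks 0 B 1 (0 : Matrix ι ι ℤ) ^ (2 * l)) =
      (A ^ m * B ^ l).trace := by
  -- Here m ≥ 1 matters: the zeroth power would have the identity in the second diagonal block and
  -- count the trace twice.
  have hA : Matrix.fromBlocks A 0 0 (0 : Matrix ι ι ℤ) ^ m = Matrix.fromBlocks (A ^ m) 0 0 0 := by
    induction m, hm using Nat.le_induction with
    | base => simp
    | succ m _ ih => rw [pow_succ, ih, Matrix.fromBlocks_multiply]; simp [pow_succ]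
  have hB : Matrix.fromBlocks 0 B 1 (0 : Matrix ι ι ℤ) ^ (2 * l) =
      Matrix.fromBlocks (B ^ l) 0 0 (B ^ l) := by
    have h2 : Matrix.fromBlocks 0 B 1 (0 : Matrix ι ι ℤ) ^ 2 = Matrix.fromBlocks B 0 0 B := by
      rw [pow_two, Matrix.fromBlocks_multiply]; simp
    rw [pow_mul, h2]
    induction l with
    | zero => simp
    | succ l ih => rw [pow_succ, ih, Matrix.fromBlocks_multiply]; simp [pow_succ]
  rw [hA, hB, Matrix.fromBlocks_multiply]
  simp [Matrix.trace, Fintype.sum_sum_type]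

end Blocks

/-! ### Matrices of partial maps -/

section PartialMap

variable {S : Type*} [Fintype S] [DecidableEq S]

/-- The `0`-`1` matrix of a partial map. -/
def partialMatrix (f : S → Option S) : Matrix S S ℤ :=
  Matrix.of fun s t => if f s = some t then 1 else 0

theorem partialMatrix_mulVec (f : S → Option S) (v : S → ℤ) (s : S) :
    (partialMatrix f).mulVec v s = (f s).elim 0 v := by
  rw [Matrix.mulVec, dotProduct]
  cases h : f s <;> simp [partialMatrix, h]

theorem partialMatrix_mul (f g : S → Option S) :
    partialMatrix f * partialMatrix g = partialMatrix fun s => (f s).bind g := by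
  ext s t
  rw [Matrix.mul_apply]
  cases h : f s with
  | none => simp [partialMatrix, h]
  | some u =>
    simp only [partialMatrix, Matrix.of_apply, h, Option.some_inj, ite_mul, one_mul, zero_mul,
      Option.bind_some]
    rw [Finset.sum_ite_eq, if_pos (Finset.mem_univ u)]

omit [Fintype S] in
theorem partialMatrix_some : partialMatrix (some : S → Option S) = 1 := by
  ext s t
  simp [partialMatrix, Matrix.one_apply]

theorem partialMatrix_equiv_pow (P : Equiv.Perm S) (l : ℕ) :
    partialMatrix (fun s => some ((P ^ l) s)) = partialMatrix (fun s => some (P s)) ^ l := by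
  induction l with
  | zero => simpa using partialMatrix_some
  | succ l ih =>
    rw [pow_succ (partialMatrix _), ← ih, partialMatrix_mul]
    simp only [pow_succ', Equiv.Perm.mul_apply, Option.bind_some]

theorem partialMatrix_foldlM {B : Type*} (δ : S → B → Option S) (w : List B) :
    partialMatrix (fun s => w.foldlM δ s) =
      (w.map fun a => partialMatrix fun s => δ s a).prod := by
  induction w with
  | nil => simpa using partialMatrix_some
  | cons a w ih =>
    rw [List.map_cons, List.prod_cons, ← ih, partialMatrix_mul]
    rfl

/-- A partial map has an infinite orbit. -/
def HasInfiniteOrbit (f : S → Option S) : Prop :=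
  ∃ s : ℕ → S, ∀ n, f (s n) = some (s (n + 1))

/-- A state has an infinite orbit iff its image is defined and has one, so the indicator of all such
states (not of a single orbit) is a nonzero fixed vector. -/
theorem det_one_sub_partialMatrix_of_hasInfiniteOrbit {f : S → Option S}
    (hf : HasInfiniteOrbit f) : (1 - partialMatrix f).det = 0 := by
  classical
  obtain ⟨s, hs⟩ := hf
  let D : Set S := {t | ∃ s : ℕ → S, s 0 = t ∧ ∀ n, f (s n) = some (s (n + 1))}
  refine Matrix.exists_mulVec_eq_zero_iff.1 ⟨D.indicator 1, ?_, ?_⟩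
  · intro h
    have := congrFun h (s 0)
    rw [Set.indicator_of_mem (show s 0 ∈ D from ⟨s, rfl, hs⟩)] at this
    simp at this
  · ext t
    rw [Matrix.sub_mulVec, Matrix.one_mulVec, Pi.sub_apply, partialMatrix_mulVec, Pi.zero_apply,
      sub_eq_zero]
    by_cases ht : t ∈ D
    · obtain ⟨s, rfl, hs⟩ := ht
      rw [Set.indicator_of_mem (show s 0 ∈ D from ⟨s, rfl, hs⟩), hs 0, Option.elim_some,
        Set.indicator_of_mem (show s (0 + 1) ∈ D from ⟨fun n => s (n + 1), rfl, fun n => hs _⟩)]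
      rfl
    · rw [Set.indicator_of_notMem ht]
      cases h : f t with
      | none => rfl
      | some t' =>
        rw [Option.elim_some, Set.indicator_of_notMem]
        rintro ⟨s, rfl, hs⟩
        refine ht ⟨fun n => Nat.casesOn n t s, rfl, fun n => ?_⟩
        cases n with
        | zero => exact h
        | succ n => exact hs n

/-- Every orbit dies after finitely many steps, and finiteness of the state set gives a common
bound. -/
theorem isNilpotent_partialMatrix {f : S → Option S} (hf : ¬ HasInfiniteOrbit f) :
    IsNilpotent (partialMatrix f) := by
  let g : ℕ → S → Option S := fun n => Nat.rec some (fun _ h s => (h s).bind f) n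
  have hg : ∀ n, partialMatrix (g n) = partialMatrix f ^ n := fun n => by
    induction n with
    | zero => exact partialMatrix_some
    | succ n ih => rw [pow_succ, ← ih, partialMatrix_mul]
  have hnone : ∀ s, ∃ n, g n s = none := by
    intro s
    by_contra! h
    choose o ho using fun n => Option.ne_none_iff_exists'.1 (h n)
    refine hf ⟨o, fun n => ?_⟩
    have := ho (n + 1)
    change (g n s).bind f = _ at this
    rwa [ho n, Option.bind_some] at this
  have hmono : ∀ s n k, g n s = none → g (n + k) s = none := by
    intro s n k h
    induction k with
    | zero => exact h
    | succ k ih =>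
      change (g (n + k) s).bind f = none
      rw [ih, Option.bind_none]
  choose n hn using hnone
  refine ⟨Finset.univ.sup n, ?_⟩
  rw [← hg]
  ext s t
  obtain ⟨k, hk⟩ := Nat.exists_eq_add_of_le (Finset.le_sup (f := n) (Finset.mem_univ s))
  rw [partialMatrix, Matrix.of_apply, hk, hmono s _ _ (hn s)]
  simp

theorem det_one_sub_eq_one_of_isNilpotent {M : Matrix S S ℤ} (hM : IsNilpotent M) :
    (1 - M).det = 1 := by
  have h := (Matrix.isNilpotent_charpoly_sub_pow_of_isNilpotent hM).eq_zero
  have h1 := M.eval_charpoly 1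
  rw [map_one, sub_eq_zero.1 h] at h1
  simpa using h1.symm

open Classical in
theorem one_sub_det_one_sub_partialMatrix (f : S → Option S) :
    1 - (1 - partialMatrix f).det = if HasInfiniteOrbit f then 1 else 0 := by
  split_ifs with h
  · rw [det_one_sub_partialMatrix_of_hasInfiniteOrbit h, sub_zero]
  · rw [det_one_sub_eq_one_of_isNilpotent (isNilpotent_partialMatrix h), sub_self]

end PartialMap

/-! ### Counting twisted periodic sequences -/

section Counting

variable {B S : Type*}

/-- A right-resolving presentation, with set of states `S`, of a closed shift-invariant set
`Y` of bi-infinite sequences, on which a permutation `τ` of the alphabet that preserves `Y`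
acts compatibly. -/
structure EquivariantPresentation (Y : Set (ℤ → B)) (τ : Equiv.Perm B) (S : Type*) where
  /-- The partially defined transition map. -/
  next : S → B → Option S
  /-- The action on states. -/
  act : Equiv.Perm S
  /-- The state of a sequence at time zero. -/
  state : (ℤ → B) → S
  mem_shift : ∀ y ∈ Y, ∀ n : ℤ, (fun i => y (i + n)) ∈ Y
  mem_perm : ∀ y ∈ Y, (fun i => τ (y i)) ∈ Y
  mem_of_approx : ∀ y : ℤ → B,
    (∀ n : ℕ, ∃ y' ∈ Y, ∀ i : ℤ, -n ≤ i → i < n → y' i = y i) → y ∈ Y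
  next_state : ∀ y ∈ Y, next (state y) (y 0) = some (state fun i => y (i + 1))
  state_perm : ∀ y ∈ Y, state (fun i => τ (y i)) = act (state y)
  next_act : ∀ s a, next (act s) (τ a) = (next s a).map act
  exists_of_foldlM : ∀ (w : List B) (s t : S), w.foldlM next s = some t →
    ∃ y ∈ Y, ∀ (i : ℕ) (h : i < w.length), y i = w[i]

namespace EquivariantPresentation

variable {Y : Set (ℤ → B)} {τ : Equiv.Perm B} (p : EquivariantPresentation Y τ S)

include p in
theorem mem_perm_pow (n : ℕ) {y : ℤ → B} (hy : y ∈ Y) : (fun i => (τ ^ n) (y i)) ∈ Y := by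
  induction n with
  | zero => exact hy
  | succ n ih =>
    simp only [pow_succ', Equiv.Perm.mul_apply]
    exact p.mem_perm _ ih

/-- The same presentation, with the action of a power of `τ`. -/
def pow (l : ℕ) : EquivariantPresentation Y (τ ^ l) S where
  next := p.next
  act := p.act ^ l
  state := p.state
  mem_shift := p.mem_shift
  mem_perm _ hy := p.mem_perm_pow l hy
  mem_of_approx := p.mem_of_approx
  next_state := p.next_state
  state_perm y hy := by
    induction l with
    | zero => rfl
    | succ l ih =>
      simp only [pow_succ', Equiv.Perm.mul_apply]
      rw [p.state_perm _ (p.mem_perm_pow l hy), ih]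
  next_act s a := by
    induction l with
    | zero => simp
    | succ l ih =>
      simp only [pow_succ', Equiv.Perm.mul_apply]
      rw [p.next_act, ih, Option.map_map]
      congr 1
  exists_of_foldlM := p.exists_of_foldlM

/-- The word read off a sequence in the window from `0` to `n - 1`. -/
def _root_.prefixWord (y : ℤ → B) (n : ℕ) : List B := List.ofFn fun i : Fin n => y i

theorem _root_.prefixWord_succ (y : ℤ → B) (n : ℕ) :
    prefixWord y (n + 1) = y 0 :: prefixWord (fun i => y (i + 1)) n := by
  simp [prefixWord, List.ofFn_succ]

theorem _root_.prefixWord_add (y : ℤ → B) (m n : ℕ) :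
    prefixWord y (m + n) = prefixWord y m ++ prefixWord (fun i => y (i + m)) n := by
  induction m generalizing y with
  | zero => simp [prefixWord]
  | succ m ih =>
    rw [show m + 1 + n = m + n + 1 by omega, prefixWord_succ, ih, prefixWord_succ]
    simp only [List.cons_append, Nat.cast_add, Nat.cast_one, add_assoc]

theorem foldlM_prefixWord {y : ℤ → B} (hy : y ∈ Y) (n : ℕ) :
    (prefixWord y n).foldlM p.next (p.state y) = some (p.state fun i => y (i + n)) := by
  induction n generalizing y with
  | zero => simp [prefixWord]
  | succ n ih =>
    rw [prefixWord_succ, List.foldlM_cons, p.next_state y hy]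
    refine (ih (p.mem_shift y hy 1)).trans ?_
    simp only [Nat.cast_add, Nat.cast_one, add_assoc]

theorem foldlM_map (w : List B) (s : S) :
    (w.map τ).foldlM p.next (p.act s) = (w.foldlM p.next s).map p.act := by
  induction w generalizing s with
  | nil => rfl
  | cons a w ih =>
    rw [List.map_cons, List.foldlM_cons, List.foldlM_cons, p.next_act]
    cases h : p.next s a with
    | none => rfl
    | some t => exact ih t

/-- The partial map on states of reading a word, followed by the action. -/
def wordMap (w : List B) (s : S) : Option S := (w.foldlM p.next s).map p.act

/-- Sequences that return to themselves after a shift by `m` and an application of `τ`. -/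
def _root_.IsTwistedPeriodic (τ : Equiv.Perm B) (m : ℕ) (y : ℤ → B) : Prop :=
  ∀ i, τ (y (i + m)) = y i

theorem _root_.IsTwistedPeriodic.zpow {m : ℕ} {y : ℤ → B} (h : IsTwistedPeriodic τ m y)
    (q i : ℤ) : (τ ^ q) (y (i + q * m)) = y i := by
  induction q with
  | zero => simp
  | succ q ih =>
    rw [zpow_add, zpow_one, Equiv.Perm.mul_apply, ← ih, ← h (i + q * m)]
    congr 3
    ring
  | pred q ih =>
    rw [← ih, zpow_sub, zpow_one, Equiv.Perm.mul_apply, ← h (i + (-q - 1) * m),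
      Equiv.Perm.inv_def, Equiv.symm_apply_apply]
    congr 2
    ring

/-- The state of y is a fixed point: reading one period leads to the state of the shifted sequence,
and τ turns that sequence back into y. -/
theorem hasInfiniteOrbit_of_mem {m : ℕ} {y : ℤ → B} (h : IsTwistedPeriodic τ m y)
    (hy : y ∈ Y) : HasInfiniteOrbit (p.wordMap (prefixWord y m)) := by
  refine ⟨fun _ => p.state y, fun _ => ?_⟩
  rw [wordMap, p.foldlM_prefixWord hy, Option.map_some,
    ← p.state_perm _ (p.mem_shift y hy m)]
  exact congrArg (fun z => some (p.state z)) (funext h)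

/-- The next block of y is τ⁻¹ of the current one, so by equivariance the orbit pulled back by
`p.act` is an orbit for the shifted sequence, and the blocks can be read one after another. -/
theorem exists_foldlM_prefixWord {m : ℕ} (n : ℕ) {y : ℤ → B} (h : IsTwistedPeriodic τ m y)
    {s : ℕ → S} (hs : ∀ n, p.wordMap (prefixWord y m) (s n) = some (s (n + 1))) :
    ∃ t, (prefixWord y (n * m)).foldlM p.next (s 0) = some t := by
  induction n generalizing y s with
  | zero => exact ⟨s 0, by simp [prefixWord]⟩
  | succ n ih =>
    have hword : (prefixWord (fun i => y (i + m)) m).map τ = prefixWord y m := by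
      rw [prefixWord, prefixWord, List.map_ofFn]
      exact congrArg List.ofFn (funext fun i => h i)
    have hs' : ∀ n, p.wordMap (prefixWord (fun i => y (i + m)) m) (p.act.symm (s (n + 1))) =
        some (p.act.symm (s (n + 2))) := by
      intro n
      have h1 := p.foldlM_map (prefixWord (fun i => y (i + m)) m) (p.act.symm (s (n + 1)))
      rw [hword, Equiv.apply_symm_apply] at h1
      have h2 := hs (n + 1)
      rw [wordMap, h1] at h2
      rw [wordMap]
      obtain ⟨t, ht, ht'⟩ := Option.map_eq_some_iff.1 h2
      rw [ht, ← ht', Equiv.symm_apply_apply]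
    obtain ⟨t, ht⟩ := ih (y := fun i => y (i + m)) (s := fun n => p.act.symm (s (n + 1)))
      (fun i => h (i + m)) hs'
    obtain ⟨u, hu, hu'⟩ := Option.map_eq_some_iff.1 (hs 0)
    refine ⟨t, ?_⟩
    rw [show (n + 1) * m = m + n * m by ring, prefixWord_add, List.foldlM_append, hu]
    have : u = p.act.symm (s (0 + 1)) := by rw [← hu', Equiv.symm_apply_apply]
    rw [this]
    exact ht

theorem mem_of_hasInfiniteOrbit {m : ℕ} (hm : 1 ≤ m) {y : ℤ → B}
    (h : IsTwistedPeriodic τ m y)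
    (hs : HasInfiniteOrbit (p.wordMap (prefixWord y m))) : y ∈ Y := by
  obtain ⟨s, hs⟩ := hs
  refine p.mem_of_approx y fun n => ?_
  obtain ⟨t, ht⟩ := p.exists_foldlM_prefixWord (2 * n) h hs
  obtain ⟨z, hz, hzy⟩ := p.exists_of_foldlM _ _ _ ht
  -- Of the 2n blocks read, shifting by n * m centres the window at 0, and τ^n undoes the twist of n
  -- periods.
  refine ⟨_, p.mem_perm_pow n (p.mem_shift z hz (n * m)), fun i hi hi' => ?_⟩
  have hnm : (n : ℤ) ≤ n * m := by nlinarith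
  obtain ⟨j, hj⟩ := Int.eq_ofNat_of_zero_le (show 0 ≤ i + n * m by omega)
  have hjl : j < 2 * n * m := by
    zify
    linarith
  have h1 := hzy j (by simpa [prefixWord] using hjl)
  rw [hj, show z j = y j by simpa [prefixWord] using h1]
  have h2 := h.zpow n i
  rw [hj] at h2
  simpa using h2

theorem _root_.IsTwistedPeriodic.ext {m : ℕ} (hm : 1 ≤ m) {y z : ℤ → B}
    (hy : IsTwistedPeriodic τ m y) (hz : IsTwistedPeriodic τ m z)
    (h : ∀ i : Fin m, y i = z i) : y = z := by
  funext i
  have hm0 : (m : ℤ) ≠ 0 := by omega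
  obtain ⟨j, hj⟩ := Int.eq_ofNat_of_zero_le (Int.emod_nonneg i hm0)
  have hjm : j < m := by
    have := Int.emod_lt_of_pos i (show (0 : ℤ) < m by omega)
    omega
  have hi : i + -(i / m) * m = j := by
    have := Int.emod_add_mul_ediv i m
    rw [hj] at this
    rw [← sub_eq_iff_eq_add.2 this.symm]
    ring
  rw [← hy.zpow (-(i / m)) i, ← hz.zpow (-(i / m)) i, hi]
  exact congrArg _ (h ⟨j, hjm⟩)

theorem _root_.exists_isTwistedPeriodic (τ : Equiv.Perm B) {m : ℕ} (hm : 1 ≤ m)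
    (w : Fin m → B) : ∃ y, IsTwistedPeriodic τ m y ∧ ∀ i : Fin m, y i = w i := by
  have hm0 : (0 : ℤ) < m := by omega
  have hlt : ∀ i : ℤ, (i % m).toNat < m := fun i => by
    have h1 := Int.emod_lt_of_pos i hm0
    have h2 := Int.emod_nonneg i hm0.ne'
    omega
  refine ⟨fun i => (τ ^ (-(i / m))) (w ⟨(i % m).toNat, hlt i⟩), fun i => ?_, fun i => ?_⟩
  · have h1 : (i + m) / m = i / m + 1 := Int.add_ediv_of_dvd_right (dvd_refl _) |>.trans
      (by rw [Int.ediv_self hm0.ne'])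
    have h2 : (i + m) % m = i % m := by simp
    simp only [h1, h2]
    rw [← Equiv.Perm.mul_apply, ← zpow_one_add]
    congr 2
    ring
  · have h1 : ((i : ℕ) : ℤ) / m = 0 := Int.ediv_eq_zero_of_lt (by omega) (by omega)
    have h2 : ((i : ℕ) : ℤ) % m = (i : ℕ) := Int.emod_eq_of_lt (by omega) (by omega)
    simp [h1, h2]

theorem image_isTwistedPeriodic {m : ℕ} (hm : 1 ≤ m) :
    (fun (y : ℤ → B) (i : Fin m) => y i) '' {y ∈ Y | IsTwistedPeriodic τ m y} =
      {w | HasInfiniteOrbit (p.wordMap (List.ofFn w))} := by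
  ext w
  constructor
  · rintro ⟨y, ⟨hy, h⟩, rfl⟩
    exact p.hasInfiniteOrbit_of_mem h hy
  · intro hw
    obtain ⟨y, h, hy⟩ := exists_isTwistedPeriodic τ hm w
    obtain rfl : (fun i : Fin m => y i) = w := funext hy
    exact ⟨y, ⟨p.mem_of_hasInfiniteOrbit hm h hw, h⟩, rfl⟩

theorem _root_.injOn_isTwistedPeriodic (Y : Set (ℤ → B)) {m : ℕ} (hm : 1 ≤ m) :
    Set.InjOn (fun (y : ℤ → B) (i : Fin m) => y i) {y ∈ Y | IsTwistedPeriodic τ m y} :=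
  fun _ hy _ hz h => hy.2.ext hm hz.2 fun i => congrFun h i

theorem _root_.finite_isTwistedPeriodic (Y : Set (ℤ → B)) [Finite B] {m : ℕ} (hm : 1 ≤ m) :
    {y ∈ Y | IsTwistedPeriodic τ m y}.Finite :=
  Set.Finite.of_finite_image (Set.toFinite _) (injOn_isTwistedPeriodic Y hm)

theorem _root_.pow_sum_eq_sum_prod_ofFn {R : Type*} [Semiring R] [Fintype B] (M : B → R)
    (m : ℕ) : (∑ a, M a) ^ m = ∑ w : Fin m → B, ((List.ofFn w).map M).prod := by
  induction m with
  | zero => simp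
  | succ m ih =>
    rw [pow_succ', ih, ← (Fin.consEquiv fun _ => B).sum_comp, Fintype.sum_prod_type,
      Finset.sum_mul_sum]
    simp [Fin.consEquiv, List.ofFn_succ]

variable [Fintype B] [Fintype S] [LinearOrder S]

/-- The sum of the compounds of the transition matrices of the letters. -/
noncomputable def transitionCompound (k : ℕ) :
    Matrix (Set.powersetCard S k) (Set.powersetCard S k) ℤ :=
  ∑ a, compoundMatrix k (partialMatrix fun s => p.next s a)

/-- The compound of the permutation matrix of the action on states. -/
noncomputable def actCompound (k : ℕ) :
    Matrix (Set.powersetCard S k) (Set.powersetCard S k) ℤ :=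
  compoundMatrix k (partialMatrix fun s => some (p.act s))

/-- Compounds turn reading a word into a product over its letters, so the sum over words is an
expanded m-th power. -/
theorem sum_compoundMatrix_wordMap (k m : ℕ) :
    ∑ w : Fin m → B, compoundMatrix k (partialMatrix (p.wordMap (List.ofFn w))) =
      p.transitionCompound k ^ m * p.actCompound k := by
  rw [transitionCompound, pow_sum_eq_sum_prod_ofFn, Finset.sum_mul]
  refine Finset.sum_congr rfl fun w _ => ?_
  have h : p.wordMap (List.ofFn w) = fun s =>
      ((List.ofFn w).foldlM p.next s).bind fun s => some (p.act s) := by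
    funext s
    rw [wordMap, Option.map_eq_bind]
    rfl
  rw [h, ← partialMatrix_mul, partialMatrix_foldlM, compoundMatrix_mul,
    compoundMatrix_list_prod, List.map_map, actCompound]
  rfl

theorem ncard_isTwistedPeriodic {m : ℕ} (hm : 1 ≤ m) :
    ({y ∈ Y | IsTwistedPeriodic τ m y}.ncard : ℤ) = ∑ k ∈ Finset.Icc 1 (Fintype.card S),
      (-1) ^ (k + 1) * (p.transitionCompound k ^ m * p.actCompound k).trace := by
  classical
  rw [← (injOn_isTwistedPeriodic Y hm).ncard_image, p.image_isTwistedPeriodic hm,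
    Set.ncard_eq_toFinset_card', Set.toFinset_ofPred, Finset.card_filter, Nat.cast_sum]
  simp only [← sum_compoundMatrix_wordMap, Matrix.trace_sum, Finset.mul_sum]
  rw [Finset.sum_comm]
  refine Finset.sum_congr rfl fun w _ => ?_
  rw [← one_sub_det_one_sub_eq_sum_trace_compoundMatrix, one_sub_det_one_sub_partialMatrix]
  split_ifs <;> simp

omit [Fintype B] in
theorem actCompound_pow (k l : ℕ) : (p.pow l).actCompound k = p.actCompound k ^ l := by
  rw [actCompound, actCompound, ← compoundMatrix_pow, ← partialMatrix_equiv_pow]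
  rfl

theorem ncard_isTwistedPeriodic_pow {m : ℕ} (hm : 1 ≤ m) (l : ℕ) :
    ({y ∈ Y | IsTwistedPeriodic (τ ^ l) m y}.ncard : ℤ) =
      ∑ k ∈ Finset.Icc 1 (Fintype.card S),
        (-1) ^ (k + 1) * (p.transitionCompound k ^ m * p.actCompound k ^ l).trace := by
  rw [(p.pow l).ncard_isTwistedPeriodic hm]
  simp only [actCompound_pow]
  rfl

end EquivariantPresentation

end Counting

/-! ### The follower-set presentation -/

section FollowerSets

variable {B : Type*}

/-- The rays that can follow the past of `y` in `Y`. -/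
def followerSet (Y : Set (ℤ → B)) (y : ℤ → B) : Set (ℕ → B) :=
  {z | ∃ y' ∈ Y, (∀ i < 0, y' i = y i) ∧ ∀ n : ℕ, y' n = z n}

/-- The ray `z` preceded by the letter `a`. -/
def consRay (a : B) (z : ℕ → B) : ℕ → B
  | 0 => a
  | n + 1 => z n

theorem consRay_preimage_followerSet {Y : Set (ℤ → B)}
    (hY : ∀ y ∈ Y, ∀ n : ℤ, (fun i => y (i + n)) ∈ Y) (y : ℤ → B) :
    consRay (y 0) ⁻¹' followerSet Y y = followerSet Y fun i => y (i + 1) := by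
  ext z
  constructor
  · rintro ⟨y', hy', hpast, hfut⟩
    refine ⟨_, hY y' hy' 1, fun i hi => ?_, fun n => hfut (n + 1)⟩
    obtain hi | rfl : i + 1 < 0 ∨ i = -1 := by omega
    · exact hpast _ hi
    · exact hfut 0
  · rintro ⟨y', hy', hpast, hfut⟩
    refine ⟨_, hY y' hy' (-1), fun i hi => ?_, fun n => ?_⟩
    · simpa using hpast (i + -1) (by omega)
    · cases n with
      | zero => simpa [consRay] using hpast (-1) (by omega)
      | succ n => simpa [consRay] using hfut n

theorem followerSet_perm {Y : Set (ℤ → B)} {τ : Equiv.Perm B}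
    (hτ : ∀ y, (fun i => τ (y i)) ∈ Y ↔ y ∈ Y) (y : ℤ → B) :
    followerSet Y (fun i => τ (y i)) = (fun z n => τ (z n)) '' followerSet Y y := by
  ext z
  constructor
  · rintro ⟨y', hy', hpast, hfut⟩
    refine ⟨fun n => τ.symm (z n), ⟨fun i => τ.symm (y' i), ?_, fun i hi => ?_, fun n => ?_⟩, ?_⟩
    · rw [← hτ]
      simpa using hy'
    · exact (congrArg _ (hpast i hi)).trans (τ.symm_apply_apply (y i))
    · exact congrArg _ (hfut n)
    · simp
  · rintro ⟨z, ⟨y', hy', hpast, hfut⟩, rfl⟩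
    exact ⟨_, (hτ y').2 hy', fun i hi => congrArg τ (hpast i hi), fun n => congrArg τ (hfut n)⟩

/-- The action on sets of rays induced by a permutation of the alphabet. -/
def raySetPerm (τ : Equiv.Perm B) : Equiv.Perm (Set (ℕ → B)) :=
  Equiv.Set.congr (Equiv.arrowCongr (Equiv.refl ℕ) τ)

theorem followerSet_perm_eq_raySetPerm {Y : Set (ℤ → B)} {τ : Equiv.Perm B}
    (hτ : ∀ y, (fun i => τ (y i)) ∈ Y ↔ y ∈ Y) (y : ℤ → B) :
    followerSet Y (fun i => τ (y i)) = raySetPerm τ (followerSet Y y) :=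
  followerSet_perm hτ y

theorem mem_raySetPerm {τ : Equiv.Perm B} {Z : Set (ℕ → B)} {z : ℕ → B} :
    z ∈ raySetPerm τ Z ↔ (fun n => τ.symm (z n)) ∈ Z := by
  constructor
  · rintro ⟨z, hz, rfl⟩
    simpa [Equiv.arrowCongr] using hz
  · intro hz
    exact ⟨_, hz, funext fun n => τ.apply_symm_apply (z n)⟩

theorem consRay_preimage_raySetPerm (τ : Equiv.Perm B) (a : B) (Z : Set (ℕ → B)) :
    consRay (τ a) ⁻¹' raySetPerm τ Z = raySetPerm τ (consRay a ⁻¹' Z) := by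
  ext z
  rw [Set.mem_preimage, mem_raySetPerm, mem_raySetPerm, Set.mem_preimage]
  have : (fun n => τ.symm (consRay (τ a) z n)) = consRay a fun n => τ.symm (z n) := by
    funext n
    cases n <;> simp [consRay]
  rw [this]

theorem raySetPerm_mem_iff {Y : Set (ℤ → B)} {τ : Equiv.Perm B}
    (hτ : ∀ y, (fun i => τ (y i)) ∈ Y ↔ y ∈ Y) (Z : Set (ℕ → B)) :
    raySetPerm τ Z ∈ followerSet Y '' Y ↔ Z ∈ followerSet Y '' Y := by
  constructor
  · rintro ⟨y, hy, h⟩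
    refine ⟨fun i => τ.symm (y i), by rw [← hτ]; simpa using hy, (raySetPerm τ).injective ?_⟩
    rw [← h, ← followerSet_perm_eq_raySetPerm hτ]
    simp
  · rintro ⟨y, hy, rfl⟩
    exact ⟨_, (hτ y).2 hy, followerSet_perm_eq_raySetPerm hτ y⟩

open Classical in
/-- The transition map between follower sets. -/
noncomputable def followerNext (Y : Set (ℤ → B)) (Z : followerSet Y '' Y) (a : B) :
    Option (followerSet Y '' Y) :=
  if h : consRay a ⁻¹' Z.1 ∈ followerSet Y '' Y then some ⟨_, h⟩ else none

theorem followerNext_eq_some {Y : Set (ℤ → B)} {Z Z' : followerSet Y '' Y} {a : B} :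
    followerNext Y Z a = some Z' ↔ consRay a ⁻¹' Z.1 = Z'.1 := by
  rw [followerNext]
  split_ifs with h
  · rw [Option.some_inj, Subtype.ext_iff]
  · simp only [false_iff]
    exact fun h' => h (h' ▸ Z'.2)

theorem exists_mem_of_foldlM_followerNext {Y : Set (ℤ → B)} (w : List B)
    {Z Z' : followerSet Y '' Y} (h : w.foldlM (followerNext Y) Z = some Z') :
    ∃ z ∈ Z.1, ∀ (i : ℕ) (hi : i < w.length), z i = w[i] := by
  induction w generalizing Z with
  | nil =>
    obtain ⟨y, hy, hyZ⟩ := Z.2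
    refine ⟨fun n => y n, ?_, fun i hi => absurd hi (Nat.not_lt_zero i)⟩
    rw [← hyZ]
    exact ⟨y, hy, fun _ _ => rfl, fun _ => rfl⟩
  | cons a w ih =>
    rw [List.foldlM_cons] at h
    obtain ⟨Z₁, h₁, h₂⟩ := Option.bind_eq_some_iff.1 h
    obtain ⟨z, hz, hzw⟩ := ih h₂
    rw [← followerNext_eq_some.1 h₁] at hz
    refine ⟨_, hz, fun i hi => ?_⟩
    cases i with
    | zero => rfl
    | succ i => exact hzw i (by simpa using hi)

open Classical in
/-- The presentation of `Y` by its follower sets. -/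
noncomputable def followerPresentation {Y : Set (ℤ → B)} {τ : Equiv.Perm B} (hne : Y.Nonempty)
    (hshift : ∀ y ∈ Y, ∀ n : ℤ, (fun i => y (i + n)) ∈ Y)
    (hτ : ∀ y, (fun i => τ (y i)) ∈ Y ↔ y ∈ Y)
    (happrox : ∀ y : ℤ → B,
      (∀ n : ℕ, ∃ y' ∈ Y, ∀ i : ℤ, -n ≤ i → i < n → y' i = y i) → y ∈ Y) :
    EquivariantPresentation Y τ (followerSet Y '' Y) where
  next := followerNext Y
  act := (raySetPerm τ).subtypeEquiv fun Z => (raySetPerm_mem_iff hτ Z).symm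
  -- The value off Y is arbitrary; only this default needs Y nonempty.
  state y := if hy : y ∈ Y then ⟨_, y, hy, rfl⟩ else ⟨_, hne.some, hne.some_mem, rfl⟩
  mem_shift := hshift
  mem_perm y hy := (hτ y).2 hy
  mem_of_approx := happrox
  next_state y hy := by
    rw [followerNext_eq_some, dif_pos hy, dif_pos (hshift y hy 1)]
    exact consRay_preimage_followerSet hshift y
  state_perm y hy := by
    rw [dif_pos hy, dif_pos ((hτ y).2 hy)]
    exact Subtype.ext (followerSet_perm_eq_raySetPerm hτ y)
  next_act Z a := by
    ext Z'
    rw [followerNext_eq_some, Option.map_eq_some_iff]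
    have h := consRay_preimage_raySetPerm τ a Z.1
    constructor
    · intro h'
      have hmem : raySetPerm τ (consRay a ⁻¹' Z.1) ∈ followerSet Y '' Y := by
        rw [← h]
        exact h' ▸ Z'.2
      exact ⟨⟨_, (raySetPerm_mem_iff hτ _).1 hmem⟩, followerNext_eq_some.2 rfl,
        Subtype.ext (h.symm.trans h')⟩
    · rintro ⟨Z₁, h₁, rfl⟩
      exact h.trans (congrArg _ (followerNext_eq_some.1 h₁))
  exists_of_foldlM w Z Z' h := by
    obtain ⟨z, hz, hzw⟩ := exists_mem_of_foldlM_followerNext w h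
    obtain ⟨y, hy, hyZ⟩ := Z.2
    rw [← hyZ] at hz
    obtain ⟨y', hy', -, hfut⟩ := hz
    exact ⟨y', hy', fun i hi => (hfut i).trans (hzw i hi)⟩

end FollowerSets

/-! ### Recoding by itineraries and finiteness of follower sets -/

section Itinerary

variable {𝒜 : Type u} [TopologicalSpace 𝒜] {X : ShiftSpace 𝒜}

theorem ShiftSpace.shift_zpow_apply (n : ℤ) (x : X.carrier) (i : ℤ) :
    ((X.shift ^ n) x).1 i = x.1 (i + n) := by
  have h1 : ∀ x i, (X.shift x).1 i = x.1 (i + 1) := fun _ _ => rfl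
  have h2 : ∀ x i, (X.shift⁻¹ x).1 i = x.1 (i - 1) := fun _ _ => rfl
  induction n generalizing x i with
  | zero => simp
  | succ n ih => rw [zpow_add_one, Homeomorph.mul_apply, ih, h1, add_assoc]
  | pred n ih =>
    rw [zpow_sub_one, Homeomorph.mul_apply, ih, h2, add_sub_assoc]

variable {G : Subgroup (X.carrier ≃ₜ X.carrier)}

/-- The sequence that records, at each time, the symbols there of all translates of `x`
under the group `G`. -/
def itinerary (G : Subgroup (X.carrier ≃ₜ X.carrier)) (x : X.carrier) : ℤ → G → 𝒜 :=
  fun i g => (g.1 x).1 i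

theorem itinerary_injective : Function.Injective (itinerary G) := fun _ _ h =>
  Subtype.ext <| funext fun i => congrFun (congrFun h i) 1

theorem itinerary_shift_zpow (hG : ∀ g ∈ G, Commute g X.shift) (n : ℤ) (x : X.carrier) (i : ℤ) :
    itinerary G ((X.shift ^ n) x) i = itinerary G x (i + n) := by
  funext g
  rw [itinerary, itinerary, ← ShiftSpace.shift_zpow_apply, ← Homeomorph.mul_apply,
    ← Homeomorph.mul_apply, ((hG g g.2).zpow_right n).eq]

/-- The permutation of the alphabet `G → 𝒜` by which `ψ` acts on itineraries. -/
def symbolPerm (𝒜 : Type*) {H : Type*} [Group H] (ψ : H) : Equiv.Perm (H → 𝒜) :=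
  Equiv.arrowCongr (Equiv.mulRight ψ).symm (Equiv.refl 𝒜)

theorem itinerary_apply_coe (ψ : G) (x : X.carrier) (i : ℤ) :
    itinerary G (ψ.1 x) i = symbolPerm 𝒜 ψ (itinerary G x i) := rfl

theorem itinerary_pow_apply (ψ : G) (l : ℕ) (x : X.carrier) (i : ℤ) :
    itinerary G ((ψ.1 ^ l) x) i = (symbolPerm 𝒜 ψ ^ l) (itinerary G x i) := by
  induction l with
  | zero => rfl
  | succ l ih =>
    rw [pow_succ', pow_succ', Equiv.Perm.mul_apply, ← ih, ← itinerary_apply_coe]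
    rfl

theorem continuous_itinerary : Continuous (itinerary G) :=
  continuous_pi fun i => continuous_pi fun g =>
    (continuous_apply i).comp (continuous_subtype_val.comp g.1.continuous)

theorem shift_mem_range_itinerary (hG : ∀ g ∈ G, Commute g X.shift) :
    ∀ y ∈ Set.range (itinerary G), ∀ n : ℤ, (fun i => y (i + n)) ∈ Set.range (itinerary G) := by
  rintro _ ⟨x, rfl⟩ n
  exact ⟨_, funext (itinerary_shift_zpow hG n x)⟩

theorem symbolPerm_mem_range_itinerary (ψ : G) (y : ℤ → G → 𝒜) :
    (fun i => symbolPerm 𝒜 ψ (y i)) ∈ Set.range (itinerary G) ↔ y ∈ Set.range (itinerary G) := by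
  constructor
  · rintro ⟨x, hx⟩
    refine ⟨ψ.1.symm x, funext fun i => (symbolPerm 𝒜 ψ).injective ?_⟩
    rw [← itinerary_apply_coe, Homeomorph.apply_symm_apply]
    exact congrFun hx i
  · rintro ⟨x, rfl⟩
    exact ⟨ψ.1 x, rfl⟩

variable [Finite 𝒜] [DiscreteTopology 𝒜] [Finite G]

instance compactSpace_carrier (X : ShiftSpace 𝒜) : CompactSpace X.carrier :=
  isCompact_iff_compactSpace.1 X.isClosed.isCompact

omit [Finite G] in
theorem mem_range_itinerary_of_approx (y : ℤ → G → 𝒜)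
    (h : ∀ n : ℕ, ∃ y' ∈ Set.range (itinerary G), ∀ i : ℤ, -n ≤ i → i < n → y' i = y i) :
    y ∈ Set.range (itinerary G) := by
  have hcl : IsClosed (Set.range (itinerary G)) :=
    (isCompact_range continuous_itinerary).isClosed
  choose u hu hu' using h
  refine hcl.mem_of_tendsto (f := u) (b := Filter.atTop) (tendsto_pi_nhds.2 fun i => ?_)
    (Filter.Eventually.of_forall hu)
  refine tendsto_const_nhds.congr' ?_
  filter_upwards [Filter.eventually_ge_atTop (i.natAbs + 1)] with n hn
  exact (hu' n i (by omega) (by omega)).symm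

/-- A Curtis–Hedlund–Lyndon argument. Were no radius enough, the pairs agreeing on [-N, N] with
different itineraries at 0 would form decreasing nonempty compact sets; a common pair would agree
everywhere and still differ. -/
theorem exists_window (G : Subgroup (X.carrier ≃ₜ X.carrier)) [Finite G]
    (hG : ∀ g ∈ G, Commute g X.shift) :
    ∃ N : ℕ, ∀ (x x' : X.carrier) (i : ℤ),
      (∀ j, i - N ≤ j → j ≤ i + N → x.1 j = x'.1 j) → itinerary G x i = itinerary G x' i := by
  suffices h : ∃ N : ℕ, ∀ x x' : X.carrier,
      (∀ j : ℤ, -N ≤ j → j ≤ N → x.1 j = x'.1 j) → itinerary G x 0 = itinerary G x' 0 by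
    obtain ⟨N, hN⟩ := h
    refine ⟨N, fun x x' i h => ?_⟩
    rw [← zero_add i, ← itinerary_shift_zpow hG, ← itinerary_shift_zpow hG]
    refine hN _ _ fun j hj hj' => ?_
    rw [ShiftSpace.shift_zpow_apply, ShiftSpace.shift_zpow_apply]
    exact h _ (by omega) (by omega)
  by_contra! hbad
  let K : ℕ → Set (X.carrier × X.carrier) := fun N =>
    {q | (∀ j : ℤ, -N ≤ j → j ≤ N → q.1.1 j = q.2.1 j) ∧ itinerary G q.1 0 ≠ itinerary G q.2 0}
  have hclosed : ∀ N, IsClosed (K N) := by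
    intro N
    have h1 : ∀ j : ℤ, IsClosed {q : X.carrier × X.carrier | q.1.1 j = q.2.1 j} := fun j =>
      isClosed_eq
      ((continuous_apply j).comp (continuous_subtype_val.comp continuous_fst))
      ((continuous_apply j).comp (continuous_subtype_val.comp continuous_snd))
    have hc : Continuous fun x => itinerary G x 0 := (continuous_apply 0).comp continuous_itinerary
    have h2 : IsClosed {q : X.carrier × X.carrier | itinerary G q.1 0 ≠ itinerary G q.2 0} :=
      (isClosed_discrete {b : (G → 𝒜) × (G → 𝒜) | b.1 ≠ b.2}).preimage
        ((hc.comp continuous_fst).prodMk (hc.comp continuous_snd))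
    have h3 : K N = (⋂ (j : ℤ) (_ : -N ≤ j) (_ : j ≤ N), {q | q.1.1 j = q.2.1 j}) ∩
        {q | itinerary G q.1 0 ≠ itinerary G q.2 0} := by
      ext q
      simp [K]
    rw [h3]
    exact (isClosed_iInter fun j => isClosed_iInter fun _ => isClosed_iInter fun _ => h1 j).inter h2
  obtain ⟨q, hq⟩ := IsCompact.nonempty_iInter_of_sequence_nonempty_isCompact_isClosed K
    (fun N q hq => ⟨fun j hj hj' => hq.1 j (by push_cast; omega) (by push_cast; omega), hq.2⟩)
    (fun N => by
      obtain ⟨x, x', h, h'⟩ := hbad N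
      exact ⟨(x, x'), h, h'⟩)
    (hclosed 0).isCompact hclosed
  rw [Set.mem_iInter] at hq
  refine (hq 0).2 (congrArg (fun x => itinerary G x 0) (Subtype.ext (funext fun j => ?_)))
  exact (hq j.natAbs).1 j (by omega) (by omega)

theorem finite_followerSet_itinerary (hX : X.IsSofic) (hG : ∀ g ∈ G, Commute g X.shift) :
    (followerSet (Set.range (itinerary G)) '' Set.range (itinerary G)).Finite := by
  obtain ⟨Γ, hΓ⟩ := hX
  obtain ⟨N, hN⟩ := exists_window G hG
  have := Γ.finite_E
  -- `K x` records the central windows of walks whose points share the itinerary past of x. It takes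
  -- finitely many values and is shown to determine the follower set.
  let K : X.carrier → Set (Set.Icc (-N : ℤ) N → Γ.E) := fun x =>
    {v | ∃ e : ℤ → Γ.E, (∀ i, Γ.target (e i) = Γ.source (e (i + 1))) ∧
      ∃ x' : X.carrier, (∀ i, x'.1 i = Γ.label (e i)) ∧
        (∀ i < 0, itinerary G x' i = itinerary G x i) ∧ ∀ i, v i = e i}
  have key : ∀ x x', K x = K x' → followerSet (Set.range (itinerary G)) (itinerary G x) ⊆
      followerSet (Set.range (itinerary G)) (itinerary G x') := by
    rintro x x' hK z ⟨_, ⟨x₁, rfl⟩, hpast, hfut⟩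
    obtain ⟨e, he, hlab⟩ : x₁.1 ∈ Γ.presented := hΓ ▸ x₁.2
    obtain ⟨e', he', x₂, hlab', hpast', hwin⟩ :
        (fun i => e i : Set.Icc (-N : ℤ) N → Γ.E) ∈ K x' :=
      hK ▸ ⟨e, he, x₁, hlab, hpast, fun _ => rfl⟩
    have hwin' : ∀ i : ℤ, -N ≤ i → i ≤ N → e i = e' i := fun i h h' => hwin ⟨i, h, h'⟩
    -- Splice the two walks at 0. They agree on [-N, N], so itineraries at negative times see only
    -- e' and those at nonnegative times only e.
    let e'' : ℤ → Γ.E := fun i => if i < 0 then e' i else e i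
    have hleft : ∀ i : ℤ, i ≤ N → e'' i = e' i := fun i hi => by
      by_cases h : i < 0
      · exact if_pos h
      · exact (if_neg h).trans (hwin' i (by omega) hi)
    have hright : ∀ i : ℤ, -N ≤ i → e'' i = e i := fun i hi => by
      by_cases h : i < 0
      · exact (if_pos h).trans (hwin' i hi (by omega)).symm
      · exact if_neg h
    have he'' : ∀ i, Γ.target (e'' i) = Γ.source (e'' (i + 1)) := fun i => by
      by_cases h : i < 0
      · rw [hleft i (by omega), hleft (i + 1) (by omega), he']
      · rw [hright i (by omega), hright (i + 1) (by omega), he]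
    have hmem : (fun i => Γ.label (e'' i)) ∈ X.carrier := hΓ ▸ ⟨e'', he'', fun _ => rfl⟩
    let x₃ : X.carrier := ⟨fun i => Γ.label (e'' i), hmem⟩
    refine ⟨itinerary G x₃, ⟨x₃, rfl⟩, fun i hi => ?_, fun n => ?_⟩
    · rw [← hpast' i hi]
      refine hN _ _ _ fun j _ hj => ?_
      rw [hlab', ← hleft j (by omega)]
    · rw [← hfut n]
      refine hN _ _ _ fun j hj _ => ?_
      rw [hlab, ← hright j (by omega)]
  rw [← Set.range_comp]
  have hfac : Function.FactorsThrough
      (followerSet (Set.range (itinerary G)) ∘ itinerary G) K := fun x x' h =>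
    (key x x' h).antisymm (key x' x h.symm)
  obtain ⟨f, hf⟩ := (Function.factorsThrough_iff _).1 hfac
  rw [hf, Set.range_comp]
  exact (Set.toFinite _).image f

omit [Finite 𝒜] [DiscreteTopology 𝒜] [Finite G] in
theorem image_itinerary_fixedSet (hG : ∀ g ∈ G, Commute g X.shift) (ψ : G) (m l : ℕ) :
    itinerary G '' {x | (X.shift ^ m) ((ψ.1 ^ l) x) = x} =
      {y ∈ Set.range (itinerary G) | IsTwistedPeriodic (symbolPerm 𝒜 ψ ^ l) m y} := by
  have h : ∀ x : X.carrier, (X.shift ^ m) ((ψ.1 ^ l) x) = x ↔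
      IsTwistedPeriodic (symbolPerm 𝒜 ψ ^ l) m (itinerary G x) := by
    intro x
    rw [← itinerary_injective (G := G).eq_iff, funext_iff]
    refine forall_congr' fun i => ?_
    rw [← zpow_natCast, itinerary_shift_zpow hG, itinerary_pow_apply]
  ext y
  constructor
  · rintro ⟨x, hx, rfl⟩
    exact ⟨⟨x, rfl⟩, (h x).1 hx⟩
  · rintro ⟨⟨x, rfl⟩, hx⟩
    exact ⟨x, (h x).2 hx, rfl⟩

end Itinerary

/-! ### Assembling the trace formula -/

theorem trace_reindexAlgEquiv {m n R : Type*} [Fintype m] [Fintype n] [DecidableEq m]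
    [DecidableEq n] [CommRing R] (e : m ≃ n) (M : Matrix m m R) :
    (Matrix.reindexAlgEquiv R R e M).trace = M.trace :=
  e.symm.sum_comp fun i => M i i

theorem exists_matrices_ncard_fixedSet {𝒜 : Type u} [Finite 𝒜] [TopologicalSpace 𝒜]
    [DiscreteTopology 𝒜] (X : ShiftSpace 𝒜) (hX : X.IsSofic)
    (ψ : X.carrier ≃ₜ X.carrier) (hcomm : Commute ψ X.shift) (hψ : IsOfFinOrder ψ) :
    ∃ (n : ℕ) (d : ℕ → ℕ) (A B : (k : ℕ) → Matrix (Fin (d k)) (Fin (d k)) ℤ),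
      ∀ m l : ℕ, 1 ≤ m →
        {x | (X.shift ^ m) ((ψ ^ l) x) = x}.Finite ∧
        ({x | (X.shift ^ m) ((ψ ^ l) x) = x}.ncard : ℤ) =
          ∑ k ∈ Finset.Icc 1 n, (-1) ^ (k + 1) * (A k ^ m * B k ^ l).trace := by
  let G := Subgroup.zpowers ψ
  have : Finite G := hψ.finite_zpowers
  have hG : ∀ g ∈ G, Commute g X.shift := by
    rintro _ ⟨n, rfl⟩
    exact hcomm.zpow_left n
  let ψ' : G := ⟨ψ, Subgroup.mem_zpowers ψ⟩
  let Y := Set.range (itinerary G)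
  have hfin : ∀ m l : ℕ, 1 ≤ m → {x | (X.shift ^ m) ((ψ ^ l) x) = x}.Finite := fun m l hm =>
    Set.Finite.of_finite_image
      (by rw [image_itinerary_fixedSet hG ψ']; exact finite_isTwistedPeriodic Y hm)
      itinerary_injective.injOn
  -- The follower presentation needs a point; for empty X the empty sum works.
  cases isEmpty_or_nonempty X.carrier with
  | inl hempty =>
    refine ⟨0, fun _ => 0, fun _ => 0, fun _ => 0, fun m l hm => ⟨hfin m l hm, ?_⟩⟩
    simp [Set.eq_empty_of_isEmpty]
  | inr hne =>
    let S := followerSet Y '' Y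
    have : Finite S := finite_followerSet_itinerary hX hG
    let : Fintype S := Fintype.ofFinite S
    let : Fintype (G → 𝒜) := Fintype.ofFinite _
    let : LinearOrder S := LinearOrder.lift' (Fintype.equivFin S) (Fintype.equivFin S).injective
    let p : EquivariantPresentation Y (symbolPerm 𝒜 ψ') S :=
      followerPresentation (Set.range_nonempty _) (shift_mem_range_itinerary hG)
        (symbolPerm_mem_range_itinerary ψ') mem_range_itinerary_of_approx
    let e : (k : ℕ) → Set.powersetCard S k ≃ Fin (Fintype.card (Set.powersetCard S k)) :=
      fun k => Fintype.equivFin _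
    refine ⟨Fintype.card S, fun k => Fintype.card (Set.powersetCard S k),
      fun k => Matrix.reindexAlgEquiv ℤ ℤ (e k) (p.transitionCompound k),
      fun k => Matrix.reindexAlgEquiv ℤ ℤ (e k) (p.actCompound k),
      fun m l hm => ⟨hfin m l hm, ?_⟩⟩
    rw [← itinerary_injective (G := G).injOn.ncard_image, image_itinerary_fixedSet hG ψ',
      p.ncard_isTwistedPeriodic_pow hm l]
    refine Finset.sum_congr rfl fun k _ => ?_
    rw [← map_pow, ← map_pow, ← map_mul, trace_reindexAlgEquiv]
    congr!

theorem IsReversal.commute_sq {X : Type*} [TopologicalSpace X] {T R : X ≃ₜ X}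
    (h : IsReversal T R) : Commute (R ^ 2) T := by
  have h1 : SemiconjBy R T⁻¹ T := (show T * R = R * T⁻¹ from Homeomorph.ext h).symm
  have h2 : SemiconjBy R T T⁻¹ := by simpa using h1.inv_right
  rw [pow_two]
  exact h1.mul_left h2

theorem theoremC {𝒜 : Type u} [Finite 𝒜] [TopologicalSpace 𝒜] [DiscreteTopology 𝒜]
    (X : ShiftSpace 𝒜) (hX : X.IsSofic)
    (φ : X.carrier ≃ₜ X.carrier) (hφ : IsReversal X.shift φ)
    (r : ℕ) (hr : 0 < r) (horder : orderOf φ = 2 * r) :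
    ∃ (n : ℕ) (d : ℕ → ℕ) (A J : (k : ℕ) → Matrix (Fin (d k)) (Fin (d k)) ℤ),
      ∀ m l : ℕ, 1 ≤ m → l < r →
        (fixedSet X.shift φ m (2 * l)).Finite ∧
        ((fixedSet X.shift φ m (2 * l)).ncard : ℤ) =
          ∑ k ∈ Finset.Icc 1 n, (-1) ^ (k + 1) * (A k ^ m * J k ^ (2 * l)).trace := by
  have hfin : IsOfFinOrder φ := orderOf_pos_iff.1 (by omega)
  obtain ⟨n, d, A, B, h⟩ :=
    exists_matrices_ncard_fixedSet X hX (φ ^ 2) hφ.commute_sq hfin.pow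
  refine ⟨n, fun k => d k + d k,
    fun k => Matrix.reindexAlgEquiv ℤ ℤ finSumFinEquiv (Matrix.fromBlocks (A k) 0 0 0),
    -- The square of this block matrix is diag(B, B), which avoids the need for an integer square
    -- root of B.
    fun k => Matrix.reindexAlgEquiv ℤ ℤ finSumFinEquiv (Matrix.fromBlocks 0 (B k) 1 0),
    fun m l hm _ => ?_⟩
  have hset : fixedSet X.shift φ m (2 * l) = {x | (X.shift ^ m) (((φ ^ 2) ^ l) x) = x} := by
    rw [fixedSet, pow_mul]
  rw [hset]
  refine ⟨(h m l hm).1, (h m l hm).2.trans (Finset.sum_congr rfl fun k _ => ?_)⟩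
  rw [← map_pow, ← map_pow, ← map_mul, trace_reindexAlgEquiv,
    trace_fromBlocks_pow_mul_pow _ _ hm]
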